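/- Let $K$ be an algebraically closed field of characteristic zero, and let $S_d$ be the $K$-vector space of homogeneous polynomials of degree $d$ in two variables $x,y$. The rank of $q\in S_d$ is the least integer $r\ge 0$ such that $q=L_1^d+\dots+L_r^d$ for some linear forms $L_1,\dots,L_r\in S_1$. Let $S_{d,r}\subseteq S_d$ be the set of forms of rank $r$ (so $S_{d,0}=\{0\}$, zero being the empty sum), and let $\overline{S_{d,r}}$ be its Zariski closure in the affine space $S_d$. Let $X\subset\mathbb P(S_d)$ be the rational normal (Veronese) curve, that is, the set of points $[L^d]$ with $0\ne L\in S_1$. A secant $k$-plane to $X$ is a $k$-dimensional projective linear subspace of $\mathbb P(S_d)$ spanned by $k+1$ points of $X$. Then for each integer $k$ with $0\le k\le\left[\frac d2\right]$ we have $$\overline{S_{d,k+1}}\setminus\overline{S_{d,k}}=S_{d,k+1}\cup S_{d,d-k+1}.$$ Moreover, for every $q\in\overline{S_{d,k+1}}\setminus\overline{S_{d,k}}$ (which is necessarily nonzero), the rank of $q$ equals $k+1$ if and only if $[q]$ lies on a secant $k$-plane to $X$; otherwise, the rank of $q$ equals $d-k+1$. -/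

import Mathlib

/-! Binary forms, their rank, Zariski closures of sets of forms, and secant planes of the
rational normal curve. -/

namespace BinaryForm

open scoped LinearAlgebra.Projectivization

/-- The space `S_d` of homogeneous polynomials of degree `d` in two variables `x = X 0`, `y = X 1`. -/
abbrev Forms (K : Type*) [Field K] (d : ℕ) : Submodule K (MvPolynomial (Fin 2) K) :=
  MvPolynomial.homogeneousSubmodule (Fin 2) K d

/-- The `d`-th power `L ^ d` of a linear form, as an element of `S_d`. -/
noncomputable def powForm {K : Type*} [Field K] (d : ℕ) (L : Forms K 1) : Forms K d :=
  ⟨(L : MvPolynomial (Fin 2) K) ^ d, by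
    have h : (L : MvPolynomial (Fin 2) K).IsHomogeneous 1 := L.2
    have h' := h.pow d
    rw [one_mul] at h'
    exact h'⟩

/-- `q` has rank `r`: `r` is the least number such that `q` is a sum of `r` `d`-th powers of
linear forms. -/
def HasRank {K : Type*} [Field K] {d : ℕ} (q : Forms K d) (r : ℕ) : Prop :=
  IsLeast {s : ℕ | ∃ L : Fin s → Forms K 1, q = ∑ i, powForm d (L i)} r

/-- The set `S_{d,r}` of binary forms of degree `d` and rank `r`. In particular `S_{d,0} = {0}`,
zero being the empty sum. -/
def formsOfRank (K : Type*) [Field K] (d r : ℕ) : Set (Forms K d) :=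
  {q | HasRank q r}

/-- The coordinates of a form in `S_d ≅ K^{d+1}`: the coefficients of `x^{d-i} y^i`, `0 ≤ i ≤ d`. -/
noncomputable def coords {K : Type*} [Field K] {d : ℕ} (q : Forms K d) : Fin (d + 1) → K :=
  fun i => MvPolynomial.coeff
    (Finsupp.single 0 (d - (i : ℕ)) + Finsupp.single 1 (i : ℕ)) (q : MvPolynomial (Fin 2) K)

/-- The Zariski closure of a set of forms in the affine space `S_d`: the common zeros of all
polynomials in the coefficients which vanish on the set. -/
def zariskiClosure {K : Type*} [Field K] {d : ℕ} (A : Set (Forms K d)) : Set (Forms K d) :=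
  {q | ∀ F : MvPolynomial (Fin (d + 1)) K,
    (∀ p ∈ A, MvPolynomial.eval (coords p) F = 0) → MvPolynomial.eval (coords q) F = 0}

/-- The Veronese curve (rational normal curve) in `ℙ(S_d)`: the points `[L ^ d]`, where `L` is a
nonzero linear form. -/
def veroneseCurve (K : Type*) [Field K] (d : ℕ) : Set (ℙ K (Forms K d)) :=
  {P | ∃ L : Forms K 1, L ≠ 0 ∧ ∃ h : powForm d L ≠ 0, P = Projectivization.mk K (powForm d L) h}

/-- `W` is a secant `k`-plane of the Veronese curve: a projective subspace spanned by `k + 1`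
independent points of the curve. -/
def IsSecantPlane {K : Type*} [Field K] {d : ℕ} (k : ℕ)
    (W : Projectivization.Subspace K (Forms K d)) : Prop :=
  ∃ P : Fin (k + 1) → ℙ K (Forms K d),
    Projectivization.Independent P ∧ (∀ i, P i ∈ veroneseCurve K d) ∧
      W = Projectivization.Subspace.span (Set.range P)

end BinaryForm

/-! The proof is Sylvester's apolarity. Write `q = ∑ (d.choose i) a_i x^(d-i) y^i`; then `q` is a
sum of `s` powers exactly when `a_0, …, a_d` is a sum of `s` geometric sequences. A form `g` of
degree `n` annihilates `q` when `∑ g_j a_(i+j) = 0` for all `i ≤ d - n`. A sum of `s` powers is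
annihilated by any form vanishing at the `s` corresponding points, and conversely an annihilator
with distinct zeros expresses `q` through the powers at these zeros (`Apolar.exists_eq_sum`).

For `d ≠ 0`, `2 * r ≤ d + 2` and `r ≤ d`, the closure of the forms of rank `r` consists of the forms
with an annihilator of degree `r` (`mem_zariskiClosure_formsOfRank_iff`). This condition is closed,
being a rank condition on a Hankel matrix; and if `g` annihilates `q`, moving `g` in a pencil whose
general member has distinct zeros carries `q` along (`Apolar.exists_deformation`).

Suppose the least degree of an annihilator is `k + 1`. The annihilators of degree `d - k + 1` then
have no common zero, so by a Bertini argument one has distinct zeros and the rank is at most `d - k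
+ 1` (`powSum_of_not_hasApolar`). Independence of few powers (`HasApolar.card_le`) excludes every
rank except `k + 1` and `d - k + 1`. Lying on a secant `k`-plane means being a combination of `k +
1` independent powers, whose coefficients are absorbed by `d`-th roots. -/

namespace BinaryForm

open Polynomial Finset

/-! ### Apolarity and sums of geometric sequences -/

section Sequences

variable {K : Type*} [Field K]

/-- The first `d + 1` terms of `a` are a sum of `s` geometric sequences `u ^ (d - i) * v ^ i`. -/
def PowSum (d : ℕ) (a : ℕ → K) (s : ℕ) : Prop :=
  ∃ u v : Fin s → K, ∀ i ≤ d, a i = ∑ l, u l ^ (d - i) * v l ^ i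

/-- The polynomial `g`, regarded as a form of degree `n`, annihilates `a_0, …, a_d`. -/
def Apolar (d n : ℕ) (g : K[X]) (a : ℕ → K) : Prop :=
  ∀ i, i + n ≤ d → ∑ j ∈ range (n + 1), g.coeff j * a (i + j) = 0

/-- Some nonzero form of degree `n` annihilates `a_0, …, a_d`. -/
def HasApolar (d n : ℕ) (a : ℕ → K) : Prop :=
  ∃ g : K[X], g ≠ 0 ∧ g.natDegree ≤ n ∧ Apolar d n g a

/-- The value at `(u, v)` of the form of degree `n` with dehomogenization `g`. -/
noncomputable def homEval (n : ℕ) (g : K[X]) (u v : K) : K :=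
  ∑ j ∈ range (n + 1), g.coeff j * (u ^ (n - j) * v ^ j)

/-- A nonzero vector as the coefficients of a polynomial. -/
lemma exists_polynomial_of_ne_zero {n : ℕ} {w : Fin (n + 1) → K} (hw : w ≠ 0) :
    ∃ g : K[X], g ≠ 0 ∧ g.natDegree ≤ n ∧ ∀ j : Fin (n + 1), g.coeff j = w j := by
  classical
  refine ⟨ofFn (n + 1) w, ?_, ?_, fun j => ?_⟩
  · intro h
    exact hw (injective_ofFn (n + 1) (by rw [h, map_zero]))
  · exact Nat.lt_succ_iff.mp (ofFn_natDegree_lt (by omega) w)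
  · exact ofFn_coeff_eq_val_of_lt w j.2

lemma exists_ne_zero_homEval_eq_zero {s n : ℕ} (hs : s ≤ n) (u v : Fin s → K) :
    ∃ g : K[X], g ≠ 0 ∧ g.natDegree ≤ n ∧ ∀ l, homEval n g (u l) (v l) = 0 := by
  let M : Matrix (Fin s) (Fin (n + 1)) K := fun l j => u l ^ (n - (j : ℕ)) * v l ^ (j : ℕ)
  obtain ⟨w, hw, hw0⟩ : ∃ w ∈ LinearMap.ker M.mulVecLin, w ≠ 0 :=
    Submodule.exists_mem_ne_zero_of_ne_bot
      (LinearMap.ker_ne_bot_of_finrank_lt (by simp; omega))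
  obtain ⟨g, h0, hd, hg⟩ := exists_polynomial_of_ne_zero hw0
  refine ⟨g, h0, hd, fun l => ?_⟩
  have := congrFun (LinearMap.mem_ker.mp hw) l
  change ∑ j, M _ j * w j = 0 at this
  rw [homEval, sum_range, ← this]
  exact sum_congr rfl fun j _ => by rw [hg, mul_comm]

/-- Contracting with `g` lowers the degree of each power by `n` and multiplies it by the value of
`g` at its point. -/
lemma sum_coeff_mul_geometric {d n s : ℕ} {a : ℕ → K} {c u v : Fin s → K}
    (ha : ∀ i ≤ d, a i = ∑ l, c l * (u l ^ (d - i) * v l ^ i)) (g : K[X]) {i : ℕ}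
    (hi : i + n ≤ d) :
    ∑ j ∈ range (n + 1), g.coeff j * a (i + j) =
      ∑ l, c l * homEval n g (u l) (v l) * (u l ^ (d - n - i) * v l ^ i) := by
  calc _ = ∑ j ∈ range (n + 1), ∑ l,
        g.coeff j * (c l * (u l ^ (d - (i + j)) * v l ^ (i + j))) := by
        refine sum_congr rfl fun j hj => ?_
        rw [mem_range] at hj
        rw [ha _ (by omega), mul_sum]
    _ = _ := by
        rw [sum_comm]
        refine sum_congr rfl fun l _ => ?_
        rw [homEval, mul_sum, sum_mul]
        refine sum_congr rfl fun j hj => ?_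
        rw [mem_range] at hj
        rw [show d - (i + j) = (n - j) + (d - n - i) by omega, pow_add, pow_add]
        ring

lemma PowSum.hasApolar {d s n : ℕ} {a : ℕ → K} (h : PowSum d a s) (hs : s ≤ n) :
    HasApolar d n a := by
  obtain ⟨u, v, ha⟩ := h
  obtain ⟨g, h0, hd, hg⟩ := exists_ne_zero_homEval_eq_zero hs u v
  refine ⟨g, h0, hd, fun i hi => ?_⟩
  rw [sum_coeff_mul_geometric (c := fun _ => 1) (u := u) (v := v) (by simpa using ha) g hi]
  simp [hg]

lemma det_projVandermonde_ne_zero {n : ℕ} {u v : Fin n → K}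
    (h : ∀ i j, i ≠ j → u i * v j ≠ u j * v i) : (Matrix.projVandermonde v u).det ≠ 0 := by
  rw [Matrix.det_projVandermonde]
  refine prod_ne_zero_iff.mpr fun i _ => prod_ne_zero_iff.mpr fun j hj => ?_
  have := h i j (by simpa using (mem_Ioi.mp hj).ne)
  intro h0
  exact this (by linear_combination h0)

/-- Powers of pairwise independent vectors are linearly independent. -/
lemma geometric_independent {s m : ℕ} (hs : s ≤ m + 1) {u v y : Fin s → K}
    (hne : ∀ l, u l ≠ 0 ∨ v l ≠ 0)
    (h : ∀ i j, i ≠ j → u i * v j ≠ u j * v i)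
    (hy : ∀ i ≤ m, ∑ l, y l * (u l ^ (m - i) * v l ^ i) = 0) : y = 0 := by
  obtain ⟨e, he⟩ : ∃ e, m + 1 = s + e := ⟨m + 1 - s, by omega⟩
  rcases Nat.eq_zero_or_pos s with rfl | hpos
  · exact Subsingleton.elim _ _
  -- Induction on the surplus of equations. With none, the matrix is a square projective
  -- Vandermonde. Otherwise the first and the last equations, each dropped in turn, are the same
  -- system for `y * v` and `y * u`, and `u l`, `v l` are not both zero.
  induction e generalizing m y with
  | zero =>
    obtain rfl : s = m + 1 := by omega
    refine Matrix.eq_zero_of_vecMul_eq_zero (det_projVandermonde_ne_zero h) ?_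
    ext j
    have hj := j.2
    rw [Pi.zero_apply, ← hy j (by omega)]
    simp only [Matrix.vecMul, dotProduct, Matrix.projVandermonde_apply]
    refine sum_congr rfl fun l _ => ?_
    have hr : (j.rev : ℕ) = m - j := by rw [Fin.val_rev]; omega
    rw [mul_comm (v l ^ _), hr]
  | succ e ih =>
    obtain ⟨m, rfl⟩ : ∃ m', m = m' + 1 := ⟨m - 1, by omega⟩
    have h1 : (fun l => y l * u l) = 0 := by
      refine ih (m := m) (by omega) (fun i hi => ?_) (by omega)
      rw [← hy i (by omega)]
      refine sum_congr rfl fun l _ => ?_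
      rw [show m + 1 - i = (m - i) + 1 by omega]
      ring
    have h2 : (fun l => y l * v l) = 0 := by
      refine ih (m := m) (by omega) (fun i hi => ?_) (by omega)
      rw [← hy (i + 1) (by omega)]
      refine sum_congr rfl fun l _ => ?_
      rw [show m + 1 - (i + 1) = m - i by omega]
      ring
    ext l
    rcases hne l with h0 | h0
    · simpa [h0] using congrFun h1 l
    · simpa [h0] using congrFun h2 l

/-- A nonzero form of degree `n` has at most `n` zeros. -/
lemma eq_zero_of_homEval_eq_zero {s n : ℕ} (hs : n < s) {u v : Fin s → K} {g : K[X]}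
    (h : ∀ i j, i ≠ j → u i * v j ≠ u j * v i) (hd : g.natDegree ≤ n)
    (hg : ∀ l, homEval n g (u l) (v l) = 0) : g = 0 := by
  have key : (fun j : Fin (n + 1) => g.coeff j) = 0 := by
    let e : Fin (n + 1) → Fin s := Fin.castLE hs
    refine Matrix.eq_zero_of_mulVec_eq_zero
      (det_projVandermonde_ne_zero (u := u ∘ e) (v := v ∘ e) fun i j hij =>
        h _ _ ((Fin.castLE_injective hs).ne hij)) ?_
    ext l
    rw [Pi.zero_apply, ← hg (e l), homEval, sum_range]
    simp only [Matrix.mulVec, dotProduct, Matrix.projVandermonde_apply]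
    refine sum_congr rfl fun j _ => ?_
    have hj : (j.rev : ℕ) = n - j := by rw [Fin.val_rev]; omega
    rw [hj, Function.comp, Function.comp]
    ring
  ext j
  by_cases hj : j < n + 1
  · simpa using congrFun key ⟨j, hj⟩
  · rw [coeff_zero, coeff_eq_zero_of_natDegree_lt (by omega)]

/-- A long sum of independent powers is not annihilated by a form of low degree. -/
lemma HasApolar.card_le {d n s : ℕ} {a : ℕ → K} (ha : HasApolar d n a) {c u v : Fin s → K}
    (hne : ∀ l, u l ≠ 0 ∨ v l ≠ 0) (hc : ∀ l, c l ≠ 0)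
    (h : ∀ i j, i ≠ j → u i * v j ≠ u j * v i)
    (has : ∀ i ≤ d, a i = ∑ l, c l * (u l ^ (d - i) * v l ^ i)) (hs : n + s ≤ d + 1) :
    s ≤ n := by
  by_contra! hlt
  obtain ⟨g, h0, hd, hg⟩ := ha
  have key : (fun l => c l * homEval n g (u l) (v l)) = 0 := by
    -- The contraction of the sum by `g` vanishes and is a combination of `s ≤ d - n + 1`
    -- independent powers of degree `d - n`; hence `g` vanishes at all `s > n` points.
    refine geometric_independent (m := d - n) (by omega) hne h fun i hi => ?_
    rw [← sum_coeff_mul_geometric has g (by omega), hg i (by omega)]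
  exact h0 (eq_zero_of_homEval_eq_zero hlt h hd fun l => by simpa [hc l] using congrFun key l)

/-- There are `d + 1 - n` equations for `n + 1` coefficients. -/
lemma hasApolar_of_lt {d n : ℕ} (a : ℕ → K) (h : d < 2 * n) : HasApolar d n a := by
  let M : Matrix (Fin (d + 1 - n)) (Fin (n + 1)) K := fun i j => a (i + j)
  obtain ⟨w, hw, hw0⟩ : ∃ w ∈ LinearMap.ker M.mulVecLin, w ≠ 0 :=
    Submodule.exists_mem_ne_zero_of_ne_bot
      (LinearMap.ker_ne_bot_of_finrank_lt (by simp; omega))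
  obtain ⟨g, h0, hd, hg⟩ := exists_polynomial_of_ne_zero hw0
  refine ⟨g, h0, hd, fun i hi => ?_⟩
  have := congrFun (LinearMap.mem_ker.mp hw) ⟨i, by omega⟩
  change ∑ j, M _ j * w j = 0 at this
  rw [sum_range, ← this]
  exact sum_congr rfl fun j _ => by rw [hg, mul_comm]

/-- A sequence annihilated by a polynomial with distinct roots is a combination of the geometric
sequences given by these roots. -/
lemma Apolar.exists_eq_sum [IsAlgClosed K] {d n : ℕ} {a : ℕ → K} {f : K[X]}
    (hf : Apolar d n f a) (hn : f.natDegree = n) (hsep : f.Separable) :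
    ∃ c x : Fin n → K, Function.Injective x ∧ ∀ i ≤ d, a i = ∑ l, c l * x l ^ i := by
  classical
  have hcard : Fintype.card (f.rootSet K) = n := by
    rw [card_rootSet_eq_natDegree hsep (IsAlgClosed.splits _), hn]
  let x : Fin n → K := fun l => ((Fintype.equivFinOfCardEq hcard).symm l : K)
  have hx : Function.Injective x :=
    Subtype.val_injective.comp (Fintype.equivFinOfCardEq hcard).symm.injective
  have hroot : ∀ l, f.eval (x l) = 0 := fun l => by
    have := mem_rootSet.mp ((Fintype.equivFinOfCardEq hcard).symm l).2
    simpa using this.2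
  have hdet : IsUnit (Matrix.vandermonde x) := by
    rw [Matrix.isUnit_iff_isUnit_det, isUnit_iff_ne_zero, Matrix.det_vandermonde_ne_zero_iff]
    exact hx
  -- Match the first `n` terms by inverting a Vandermonde matrix; the recurrence given by `f`, with
  -- nonzero leading coefficient, determines the others.
  obtain ⟨c, hc⟩ := Matrix.vecMul_surjective_iff_isUnit.mpr hdet (fun i : Fin n => a i)
  refine ⟨c, x, hx, ?_⟩
  have hlead : f.coeff n ≠ 0 := by
    rw [← hn]
    exact leadingCoeff_ne_zero.mpr hsep.ne_zero
  intro i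
  induction i using Nat.strong_induction_on with
  | _ i ih =>
    intro hi
    by_cases hin : i < n
    · have := congrFun hc ⟨i, hin⟩
      simpa [Matrix.vecMul, dotProduct] using this.symm
    · obtain ⟨m, rfl⟩ : ∃ m, i = m + n := ⟨i - n, by omega⟩
      have h1 := hf m hi
      have h2 : ∑ j ∈ range (n + 1), f.coeff j * (∑ l, c l * x l ^ (m + j)) = 0 := by
        simp_rw [mul_sum]
        rw [sum_comm]
        refine sum_eq_zero fun l _ => ?_
        have := hroot l
        rw [eval_eq_sum_range, hn] at this
        rw [← mul_zero (c l * x l ^ m), ← this, mul_sum]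
        exact sum_congr rfl fun j _ => by ring
      rw [sum_range_succ] at h1 h2
      have h3 : ∑ j ∈ range n, f.coeff j * a (m + j) =
          ∑ j ∈ range n, f.coeff j * (∑ l, c l * x l ^ (m + j)) :=
        sum_congr rfl fun j hj => by
          rw [mem_range] at hj
          rw [ih (m + j) (by omega) (by omega)]
      refine mul_left_cancel₀ hlead ?_
      linear_combination h1 - h2 - h3

/-- A `d`-th root of each coefficient is absorbed into its linear form, which is where `d ≠ 0`
enters. -/
lemma powSum_of_eq_sum [IsAlgClosed K] {d n : ℕ} (hd : d ≠ 0) {a : ℕ → K} {c u v : Fin n → K}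
    (h : ∀ i ≤ d, a i = ∑ l, c l * (u l ^ (d - i) * v l ^ i)) : PowSum d a n := by
  choose e he using fun l => IsAlgClosed.exists_pow_nat_eq (c l) (Nat.pos_of_ne_zero hd)
  refine ⟨fun l => e l * u l, fun l => e l * v l, fun i hi => ?_⟩
  rw [h i hi]
  refine sum_congr rfl fun l _ => ?_
  rw [mul_pow, mul_pow, ← he, show e l ^ d = e l ^ (d - i) * e l ^ i by
    rw [← pow_add, Nat.sub_add_cancel hi]]
  ring

/-! ### Pencils and annihilators with distinct zeros -/

/-- All but finitely many members of a pencil without base points are separable. -/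
lemma finite_not_separable [IsAlgClosed K] [CharZero K] {f h : K[X]} (hfh : IsCoprime f h)
    (hh : h.natDegree ≠ 0) : {t : K | ¬ (f + C t * h).Separable}.Finite := by
  classical
  -- At a multiple root `x` of `f + t h` the Wronskian vanishes, and `h x ≠ 0` by coprimality, so `t
  -- = -f x / h x`. Only finitely many `x`, hence `t`, occur.
  have hW : wronskian f h ≠ 0 := fun h0 =>
    hh (derivative_eq_zero.mp (hfh.wronskian_eq_zero_iff.mp h0).2)
  refine ((wronskian f h).roots.toFinset.finite_toSet.image
    fun x => -(f.eval x / h.eval x)).subset fun t ht => ?_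
  have ht' : ¬ IsCoprime (f + C t * h) (derivative (f + C t * h)) := ht
  rw [isCoprime_iff_aeval_ne_zero_of_isAlgClosed K K] at ht'
  push Not at ht'
  obtain ⟨x, hx1, hx2⟩ := ht'
  simp only [coe_aeval_eq_eval, derivative_add, derivative_C_mul, eval_add, eval_mul, eval_C]
    at hx1 hx2
  have hhx : h.eval x ≠ 0 := by
    intro h0
    have := (isCoprime_iff_aeval_ne_zero_of_isAlgClosed K K f h).mp hfh x
    simp only [coe_aeval_eq_eval, h0, mul_zero, add_zero] at this hx1
    simp [hx1] at this
  refine ⟨x, ?_, ?_⟩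
  · rw [Finset.mem_coe, Multiset.mem_toFinset, mem_roots hW, IsRoot.def, wronskian, eval_sub,
      eval_mul, eval_mul]
    linear_combination (derivative h).eval x * hx1 - h.eval x * hx2
  · field_simp
    linear_combination -hx1

/-- A pencil of forms of degree `n` without base points, one of them not vanishing at infinity:
all but finitely many members have `n` distinct zeros, none at infinity. -/
lemma finite_not_separable_or_natDegree_ne [IsAlgClosed K] [CharZero K] {n : ℕ} {f h : K[X]}
    (hfh : IsCoprime f h) (hf : f.natDegree ≤ n) (hh : h.natDegree = n) (hh0 : h ≠ 0) :
    ∃ T : Set K, T.Finite ∧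
      ∀ t ∉ T, (f + C t * h).Separable ∧ (f + C t * h).natDegree = n := by
  have hlead : h.coeff n ≠ 0 := by rw [← hh]; exact leadingCoeff_ne_zero.mpr hh0
  have hdeg : ∀ t, t ≠ -(f.coeff n / h.coeff n) → (f + C t * h).coeff n ≠ 0 := by
    intro t ht h0
    refine ht ?_
    rw [coeff_add, coeff_C_mul] at h0
    field_simp
    linear_combination h0
  have hle : ∀ t, (f + C t * h).natDegree ≤ n := fun t =>
    natDegree_add_le_of_degree_le hf ((natDegree_C_mul_le _ _).trans hh.le)
  have heq : ∀ t, t ≠ -(f.coeff n / h.coeff n) → (f + C t * h).natDegree = n := fun t ht =>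
    natDegree_eq_of_le_of_coeff_ne_zero (hle t) (hdeg t ht)
  rcases Nat.eq_zero_or_pos n with rfl | hn
  · refine ⟨{-(f.coeff 0 / h.coeff 0)}, Set.finite_singleton _, fun t ht => ⟨?_, heq t ht⟩⟩
    rw [eq_C_of_natDegree_eq_zero (heq t ht)]
    exact (separable_C _).mpr (hdeg t ht).isUnit
  · refine ⟨{t | ¬ (f + C t * h).Separable} ∪ {-(f.coeff n / h.coeff n)},
      (finite_not_separable hfh (by omega)).union (Set.finite_singleton _), fun t ht => ?_⟩
    simp only [Set.mem_union, Set.mem_ofPred_eq, Set.mem_singleton_iff, not_or, not_not] at ht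
    exact ⟨ht.1, heq t ht.2⟩

/-- The functional `w ↦ ∑ w_j b_j`. -/
noncomputable def pairing (n : ℕ) (b : ℕ → K) : Module.Dual K (Fin n → K) :=
  ∑ j : Fin n, b j • LinearMap.proj j

lemma pairing_apply (n : ℕ) (b : ℕ → K) (w : Fin n → K) : pairing n b w = ∑ j : Fin n, b j * w j := by
  simp [pairing]

/-- A functional vanishing on the common kernel of finitely many functionals lies in their span. -/
lemma exists_forall_pairing_eq_zero_and_ne_zero {n k : ℕ} {a b : ℕ → K}
    (h : ∀ c : Fin k → K, ¬ ∀ j < n, b j = ∑ i, c i * a (i + j)) :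
    ∃ w ∈ ⨅ i : Fin k, LinearMap.ker (pairing n fun j => a (i + j)), pairing n b w ≠ 0 := by
  by_contra! hcon
  have := mem_span_of_iInf_ker_le_ker (L := fun i : Fin k => pairing n fun j => a (i + j))
    (K := pairing n b) fun w hw => hcon w hw
  obtain ⟨c, hc⟩ := (Submodule.mem_span_range_iff_exists_fun K).mp this
  refine h c fun j hj => ?_
  have h1 := LinearMap.congr_fun hc (Pi.single ⟨j, hj⟩ 1)
  simp only [LinearMap.sum_apply, LinearMap.smul_apply, pairing_apply, Pi.single_apply,
    smul_eq_mul, mul_ite, mul_one, mul_zero, sum_ite_eq', mem_univ, if_true] at h1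
  exact h1.symm

/-- If `a_0, …, a_d` has no annihilator of degree `k`, its annihilators of degree `d - k + 1`
contain a form with distinct zeros, none at infinity. -/
lemma exists_separable_apolar [IsAlgClosed K] [CharZero K] {d k : ℕ} (hk : k ≤ d) {a : ℕ → K}
    (ha : ¬ HasApolar d k a) :
    ∃ f : K[X], f.natDegree = d - k + 1 ∧ f.Separable ∧ Apolar d (d - k + 1) f a := by
  classical
  obtain ⟨n, hn⟩ : ∃ n, d - k + 1 = n := ⟨_, rfl⟩
  rw [hn]
  let V := ⨅ i : Fin k, LinearMap.ker (pairing (n + 1) fun j => a (i + j))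
  have hV : ∀ w ∈ V, Apolar d n (ofFn (n + 1) w) a := by
    intro w hw i hi
    have := (Submodule.mem_iInf _).mp hw ⟨i, by omega⟩
    rw [LinearMap.mem_ker, pairing_apply] at this
    rw [sum_range, ← this]
    exact sum_congr rfl fun j _ => by rw [ofFn_coeff_eq_val_of_lt w j.2, mul_comm]
  have hdeg : ∀ w : Fin (n + 1) → K, (ofFn (n + 1) w).natDegree ≤ n := fun w =>
    Nat.lt_succ_iff.mp (ofFn_natDegree_lt (by omega) w)
  have hno : ∀ g : K[X], g.natDegree ≤ k → (∀ i, i + k ≤ d →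
      ∑ j ∈ range (k + 1), g.coeff j * a (i + j) = 0) → g = 0 := by
    intro g hg h
    by_contra h0
    exact ha ⟨g, h0, hg, h⟩
  -- No common zero at infinity: otherwise the coefficient of `X ^ n` is a combination of the `k`
  -- equations defining `V`, and the multipliers `c` give a nonzero annihilator of degree `k`.
  obtain ⟨h, hhV, hh⟩ : ∃ h ∈ V, pairing (n + 1) (Pi.single n 1) h ≠ 0 := by
    refine exists_forall_pairing_eq_zero_and_ne_zero fun c hc => ?_
    have hg : ofFn k c = 0 := by
      refine hno _ ?_ fun i hi => ?_
      · rcases Nat.eq_zero_or_pos k with rfl | hk0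
        · simp
        · exact (ofFn_natDegree_lt hk0 c).le
      · have := hc i (by omega)
        rw [Pi.single_apply, if_neg (by omega)] at this
        rw [sum_range_succ, ofFn_coeff_eq_zero_of_ge c le_rfl, zero_mul, add_zero, sum_range, this]
        exact sum_congr rfl fun j _ => by
          rw [ofFn_coeff_eq_val_of_lt c j.2, add_comm i]
    have hc0 : c = 0 := injective_ofFn k (by rw [hg, map_zero])
    have := hc n (by omega)
    simp [hc0] at this
  have hlead : (ofFn (n + 1) h).coeff n ≠ 0 := by
    rw [pairing_apply, Finset.sum_eq_single (Fin.last n)] at hh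
    · rw [ofFn_coeff_eq_val_of_lt h (Nat.lt_succ_self n)]
      simpa [Fin.last] using hh
    · intro j _ hj
      rw [Pi.single_apply, if_neg, zero_mul]
      simpa [Fin.ext_iff] using hj
    · simp
  have hh0 : ofFn (n + 1) h ≠ 0 := fun h0 => hlead (by rw [h0, coeff_zero])
  have hhn : (ofFn (n + 1) h).natDegree = n :=
    natDegree_eq_of_le_of_coeff_ne_zero (hdeg h) hlead
  -- No common zero at a root `x` of `h`: otherwise `∑ c_i a_(i+j) = x ^ j`, so `(X - x) * c`
  -- annihilates in degree `k`. As `K` is infinite, one `f` avoids all the finitely many roots.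
  obtain ⟨f, hfV, hf⟩ : ∃ f ∈ V, ∀ x : (ofFn (n + 1) h).roots.toFinset,
      pairing (n + 1) (fun j => (x : K) ^ j) f ≠ 0 := by
    refine Module.Dual.exists_forall_mem_ne_zero_of_forall_exists V _ fun x => ?_
    refine exists_forall_pairing_eq_zero_and_ne_zero fun c hc => ?_
    have hg : (X - C (x : K)) * ofFn k c = 0 := by
      refine hno _ ?_ fun i hi => ?_
      · rcases Nat.eq_zero_or_pos k with rfl | hk0
        · simp
        · have := ofFn_natDegree_lt hk0 c
          refine natDegree_mul_le.trans ?_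
          rw [natDegree_X_sub_C]
          omega
      · have h1 := hc i (by omega)
        have h2 := hc (i + 1) (by omega)
        have h3 : ∑ j ∈ range k, (ofFn k c).coeff j * a (i + (j + 1)) = x ^ (i + 1) := by
          rw [h2, sum_range]
          exact sum_congr rfl fun j _ => by
            rw [ofFn_coeff_eq_val_of_lt c j.2, add_left_comm]
        have h4 : ∑ j ∈ range k, (ofFn k c).coeff j * a (i + j) = x ^ i := by
          rw [h1, sum_range]
          exact sum_congr rfl fun j _ => by rw [ofFn_coeff_eq_val_of_lt c j.2, add_comm i]
        rw [sum_congr rfl (g := fun j => (X * ofFn k c).coeff j * a (i + j) -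
          x * ((ofFn k c).coeff j * a (i + j))) fun j _ => by
            rw [sub_mul, coeff_sub, coeff_C_mul]; ring, sum_sub_distrib, ← mul_sum,
          sum_range_succ', sum_range_succ (fun j => (ofFn k c).coeff j * a (i + j)),
          ofFn_coeff_eq_zero_of_ge c le_rfl]
        simp only [coeff_X_mul, coeff_X_mul_zero, zero_mul, add_zero]
        rw [h3, h4]
        ring
    have hg' : ofFn k c = 0 := (mul_eq_zero.mp hg).resolve_left (X_sub_C_ne_zero _)
    have hc0 : c = 0 := injective_ofFn k (by rw [hg', map_zero])
    have := hc 0 (by omega)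
    simp [hc0] at this
  have hcop : IsCoprime (ofFn (n + 1) f) (ofFn (n + 1) h) := by
    rw [isCoprime_iff_aeval_ne_zero_of_isAlgClosed K K]
    intro x
    simp only [coe_aeval_eq_eval]
    by_cases hx : (ofFn (n + 1) h).eval x = 0
    · left
      have := hf ⟨x, by rw [Multiset.mem_toFinset, mem_roots hh0]; exact hx⟩
      rw [pairing_apply] at this
      rw [eval_eq_sum_range' (Nat.lt_succ_of_le (hdeg f)), sum_range]
      convert this using 1
      exact sum_congr rfl fun j _ => by rw [ofFn_coeff_eq_val_of_lt f j.2, mul_comm]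
    · exact Or.inr hx
  obtain ⟨T, hT, hTt⟩ := finite_not_separable_or_natDegree_ne hcop (hdeg f) hhn hh0
  obtain ⟨t, ht⟩ := hT.exists_notMem
  refine ⟨_, (hTt t ht).2, (hTt t ht).1, fun i hi => ?_⟩
  have h1 := hV f hfV i hi
  have h2 := hV h hhV i hi
  simp only [coeff_add, coeff_C_mul, add_mul, sum_add_distrib, mul_assoc, ← mul_sum]
  rw [h1, h2]
  ring

/-- If `a_0, …, a_d` has no annihilator of degree `k`, it is a sum of `d - k + 1` powers. -/
lemma powSum_of_not_hasApolar [IsAlgClosed K] [CharZero K] {d k : ℕ} (hd : d ≠ 0) (hk : k ≤ d)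
    {a : ℕ → K} (ha : ¬ HasApolar d k a) : PowSum d a (d - k + 1) := by
  obtain ⟨f, hf, hsep, hap⟩ := exists_separable_apolar hk ha
  obtain ⟨c, x, -, h⟩ := hap.exists_eq_sum hf hsep
  exact powSum_of_eq_sum hd (c := c) (u := fun _ => 1) (v := x) (by simpa using h)

/-! ### Deforming a sequence along with its annihilator -/

/-- The matrix of multiplication by `f`: row `i` holds the coefficients of `X ^ i * f`. -/
noncomputable def shiftMatrix {R : Type*} [Semiring R] (e m : ℕ) (f : R[X]) :
    Matrix (Fin e) (Fin m) R :=
  .of fun i j => (X ^ (i : ℕ) * f).coeff j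

lemma shiftMatrix_mulVec {d n : ℕ} {f : K[X]} (hf : f.natDegree ≤ n)
    (a : ℕ → K) (i : Fin (d + 1 - n)) :
    (shiftMatrix (d + 1 - n) (d + 1) f).mulVec (fun j => a j) i =
      ∑ j ∈ range (n + 1), f.coeff j * a (i + j) := by
  obtain ⟨i, hi⟩ := i
  have h1 : (shiftMatrix (d + 1 - n) (d + 1) f).mulVec (fun j => a j) ⟨i, hi⟩ =
      ∑ j ∈ range (d + 1), (X ^ i * f).coeff j * a j := by
    rw [sum_range]; rfl
  rw [h1]
  clear h1
  change _ = ∑ j ∈ range (n + 1), f.coeff j * a (i + j)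
  rw [show d + 1 = i + (n + 1) + (d - n - i) from (by omega), sum_range_add, sum_range_add,
    sum_eq_zero, sum_eq_zero (s := range (d - n - i)), zero_add, add_zero]
  · refine sum_congr rfl fun j _ => ?_
    rw [add_comm (i : ℕ) j, coeff_X_pow_mul]
  · intro j _
    rw [show (i : ℕ) + (n + 1) + j = (n + 1 + j) + i by omega, coeff_X_pow_mul,
      coeff_eq_zero_of_natDegree_lt (by omega), zero_mul]
  · intro j hj
    rw [coeff_X_pow_mul', if_neg (by simpa using hj), zero_mul]

lemma apolar_iff_shiftMatrix {d n : ℕ} {f : K[X]} (hf : f.natDegree ≤ n) (a : ℕ → K) :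
    Apolar d n f a ↔
      (shiftMatrix (d + 1 - n) (d + 1) f).mulVec (fun j => a j) = 0 := by
  constructor
  · intro h
    ext i
    rw [shiftMatrix_mulVec hf]
    exact h i (by omega)
  · intro h i hi
    have := congrFun h ⟨i, by omega⟩
    rwa [shiftMatrix_mulVec hf] at this

/-- The transpose is multiplication by `f` on polynomials of degree at most `d - n`, which is
injective. -/
lemma exists_shiftMatrix_mul_eq_one {d n : ℕ} {f : K[X]} (hf : f.natDegree ≤ n) (h0 : f ≠ 0)
    (hn : n ≤ d) : ∃ N : Matrix (Fin (d + 1)) (Fin (d + 1 - n)) K,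
      shiftMatrix (d + 1 - n) (d + 1) f * N = 1 := by
  classical
  set M := shiftMatrix (d + 1 - n) (d + 1) f
  have hinj : LinearMap.ker (Matrix.toLin' M.transpose) = ⊥ := by
    rw [LinearMap.ker_eq_bot']
    intro c hc
    have key : ofFn (d + 1 - n) c * f = 0 := by
      have hdeg : (ofFn (d + 1 - n) c).natDegree < d + 1 - n := ofFn_natDegree_lt (by omega) c
      ext m
      rw [coeff_zero]
      by_cases hm : m < d + 1
      · refine Eq.trans ?_ (congrFun hc ⟨m, hm⟩)
        rw [ofFn_eq_sum_monomial, sum_mul, finsetSum_coeff,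
          Matrix.toLin'_apply]
        refine sum_congr rfl fun i _ => ?_
        rw [← C_mul_X_pow_eq_monomial, mul_assoc, coeff_C_mul, mul_comm]
        rfl
      · refine coeff_eq_zero_of_natDegree_lt (natDegree_mul_le.trans_lt ?_)
        omega
    exact injective_ofFn _ (by rw [(mul_eq_zero.mp key).resolve_right h0, map_zero])
  obtain ⟨g, hg⟩ := LinearMap.exists_leftInverse_of_injective _ hinj
  refine ⟨(LinearMap.toMatrix' g).transpose, ?_⟩
  rw [← Matrix.transpose_transpose M, ← Matrix.transpose_mul]
  have := congrArg LinearMap.toMatrix' hg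
  rw [LinearMap.toMatrix'_comp, LinearMap.toMatrix'_toLin', LinearMap.toMatrix'_id] at this
  rw [this, Matrix.transpose_one]

/-- An annihilator of `a_0, …, a_d` moving in a pencil is followed by a polynomial deformation of
the sequence. -/
lemma Apolar.exists_deformation {d n : ℕ} (hn : n ≤ d) {a : ℕ → K} {g h : K[X]}
    (hg : g.natDegree ≤ n) (hh : h.natDegree ≤ n) (h0 : g ≠ 0) (ha : Apolar d n g a) :
    ∃ P : ℕ → K[X], (∀ i ≤ d, (P i).eval 0 = a i) ∧
      ∀ t, Apolar d n (g + C t * h) fun i => (P i).eval t := by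
  obtain ⟨N, hN⟩ := exists_shiftMatrix_mul_eq_one (d := d) hg h0 hn
  set Mg := shiftMatrix (d + 1 - n) (d + 1) g with hMg
  set Mh := shiftMatrix (d + 1 - n) (d + 1) h with hMh
  let M : Matrix (Fin (d + 1 - n)) (Fin (d + 1)) K[X] := Mg.map C + (X : K[X]) • Mh.map C
  have hM : ∀ t, M.map (evalRingHom t) = shiftMatrix (d + 1 - n) (d + 1) (g + C t * h) := by
    intro t
    ext i j
    simp only [M, hMg, hMh, shiftMatrix, Matrix.map_apply, Matrix.add_apply, Matrix.smul_apply,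
      Matrix.of_apply, smul_eq_mul, coe_evalRingHom, eval_add, eval_mul, eval_C, eval_X, mul_add,
      coeff_add, mul_left_comm (X ^ (i : ℕ)) (C t), coeff_C_mul]
  let N' : Matrix (Fin (d + 1)) (Fin (d + 1 - n)) K[X] := N.map C
  let a' : Fin (d + 1) → K[X] := fun j => C (a j)
  -- The projection `a - N (M N)⁻¹ M a` onto the kernel of `M`, with the denominator `det (M N)`
  -- cleared. At `t = 0` one has `M N = 1` and `M a = 0`, so it returns `a`.
  let p : Fin (d + 1) → K[X] :=
    (M * N').det • a' - N'.mulVec ((M * N').adjugate.mulVec (M.mulVec a'))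
  have hp : M.mulVec p = 0 := by
    simp only [p]
    rw [Matrix.mulVec_sub, Matrix.mulVec_smul, Matrix.mulVec_mulVec, Matrix.mulVec_mulVec,
      Matrix.mul_adjugate, Matrix.smul_mulVec, Matrix.one_mulVec, sub_self]
  have hdeg : ∀ t, (g + C t * h).natDegree ≤ n := fun t =>
    natDegree_add_le_of_degree_le hg ((natDegree_C_mul_le _ _).trans hh)
  let P : ℕ → K[X] := fun i => if hi : i < d + 1 then p ⟨i, hi⟩ else 0
  have hP : ∀ t, (fun j : Fin (d + 1) => (P j).eval t) = evalRingHom t ∘ p := by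
    intro t
    ext j
    simp only [P, dif_pos j.2, Function.comp, coe_evalRingHom]
  refine ⟨P, fun i hi => ?_, fun t => ?_⟩
  · have hM0 : M.map (evalRingHom 0) = Mg := by rw [hM 0]; simp [hMg]
    have hN0 : N'.map (evalRingHom 0) = N := by ext i j; simp [N']
    have ha0 : evalRingHom 0 ∘ a' = fun j : Fin (d + 1) => a j := by ext j; simp [a']
    have hdet : (M * N').det.eval 0 = 1 := by
      rw [← coe_evalRingHom, RingHom.map_det, RingHom.mapMatrix_apply, Matrix.map_mul, hM0, hN0,
        hN, Matrix.det_one]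
    have hMa : evalRingHom 0 ∘ M.mulVec a' = 0 := by
      ext j
      rw [Function.comp, RingHom.map_mulVec, hM0, ha0, (apolar_iff_shiftMatrix hg a).mp ha]
    have hcor : ∀ j, (N'.mulVec ((M * N').adjugate.mulVec (M.mulVec a')) j).eval 0 = 0 := by
      intro j
      rw [Matrix.mulVec_mulVec, ← coe_evalRingHom, RingHom.map_mulVec, hMa, Matrix.mulVec_zero,
        Pi.zero_apply]
    have : (P i).eval 0 = (p ⟨i, by omega⟩).eval 0 := by
      simp only [P, dif_pos (Nat.lt_succ_of_le hi)]
    rw [this]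
    simp only [p, Pi.sub_apply, Pi.smul_apply, eval_sub, hcor, sub_zero, smul_eq_mul, eval_mul,
      hdet, one_mul, a', eval_C]
  · rw [apolar_iff_shiftMatrix (hdeg t), hP t, ← hM t]
    ext j
    rw [← RingHom.map_mulVec, hp]
    simp

/-- A sequence with an annihilator of degree `n` is a limit of combinations of `n` powers. -/
lemma HasApolar.exists_deformation [IsAlgClosed K] [CharZero K] {d n : ℕ} (hn : n ≤ d)
    {a : ℕ → K} (ha : HasApolar d n a) :
    ∃ P : ℕ → K[X], (∀ i ≤ d, (P i).eval 0 = a i) ∧ ∃ T : Set K, T.Finite ∧ ∀ t ∉ T,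
      ∃ c x : Fin n → K, Function.Injective x ∧ ∀ i ≤ d, (P i).eval t = ∑ l, c l * x l ^ i := by
  classical
  obtain ⟨g, h0, hg, hga⟩ := ha
  -- Away from the roots of `g`, the power `(X - c) ^ n` is coprime to `g` and has degree exactly
  -- `n`.
  obtain ⟨c, hc⟩ := Infinite.exists_notMem_finset g.roots.toFinset
  have hc' : g.eval c ≠ 0 := by
    rw [Multiset.mem_toFinset, mem_roots h0] at hc
    exact hc
  have hh : ((X - C c) ^ n).natDegree = n := by rw [natDegree_pow, natDegree_X_sub_C, mul_one]
  have hcop : IsCoprime g ((X - C c) ^ n) := by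
    refine IsCoprime.pow_right ?_
    rw [isCoprime_comm, (irreducible_X_sub_C c).coprime_iff_not_dvd, dvd_iff_isRoot]
    exact hc'
  obtain ⟨P, hP0, hP⟩ := hga.exists_deformation hn hg hh.le h0
  obtain ⟨T, hT, hTt⟩ :=
    finite_not_separable_or_natDegree_ne hcop hg hh (pow_ne_zero _ (X_sub_C_ne_zero c))
  exact ⟨P, hP0, T, hT, fun t ht => (hP t).exists_eq_sum (hTt t ht).2 (hTt t ht).1⟩

/-! ### Having an annihilator is a closed condition -/

/-- The sequences without annihilator of degree `n` form a Zariski open set. -/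
lemma exists_mvPolynomial_of_not_hasApolar {d n : ℕ} {a : ℕ → K}
    (ha : ¬ HasApolar d n a) :
    ∃ F : MvPolynomial (Fin (d + 1)) K,
      (∀ b : ℕ → K, HasApolar d n b → MvPolynomial.eval (fun i : Fin (d + 1) => b i) F = 0) ∧
      MvPolynomial.eval (fun i : Fin (d + 1) => a i) F ≠ 0 := by
  classical
  let H : (ℕ → K) → Matrix (Fin (d + 1 - n)) (Fin (n + 1)) K :=
    fun b => .of fun i j => b (i + j)
  have hH : ∀ b, HasApolar d n b ↔ ∃ w ≠ 0, (H b).mulVec w = 0 := by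
    intro b
    constructor
    · rintro ⟨g, h0, hg, h⟩
      refine ⟨fun j => g.coeff j, fun hz => h0 ?_, ?_⟩
      · ext j
        by_cases hj : j < n + 1
        · simpa using congrFun hz ⟨j, hj⟩
        · rw [coeff_zero, coeff_eq_zero_of_natDegree_lt (by omega)]
      · ext i
        rw [Pi.zero_apply, ← h i (by omega), sum_range]
        change ∑ j : Fin (n + 1), b (i + j) * g.coeff j = _
        exact sum_congr rfl fun j _ => mul_comm _ _
    · rintro ⟨w, hw0, hw⟩
      obtain ⟨g, h0, hd, hg⟩ := exists_polynomial_of_ne_zero hw0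
      refine ⟨g, h0, hd, fun i hi => ?_⟩
      have : ∑ j, H b ⟨i, by omega⟩ j * w j = 0 := congrFun hw ⟨i, by omega⟩
      rw [sum_range, ← this]
      exact sum_congr rfl fun j _ => by rw [hg, mul_comm]; rfl
  have hinj : LinearMap.ker (Matrix.toLin' (H a)) = ⊥ := by
    rw [LinearMap.ker_eq_bot']
    intro w hw
    by_contra hw0
    exact ha ((hH a).mpr ⟨w, hw0, hw⟩)
  -- For a left inverse `N` of the Hankel matrix of `a`, the polynomial `det (N * H b)` is 1 at `a`
  -- and vanishes as soon as `H b` has a kernel. This replaces a choice of maximal minor.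
  obtain ⟨g, hg⟩ := LinearMap.exists_leftInverse_of_injective _ hinj
  set N := LinearMap.toMatrix' g
  have hN : N * H a = 1 := by
    have := congrArg LinearMap.toMatrix' hg
    rwa [LinearMap.toMatrix'_comp, LinearMap.toMatrix'_toLin', LinearMap.toMatrix'_id] at this
  let G : Matrix (Fin (d + 1 - n)) (Fin (n + 1)) (MvPolynomial (Fin (d + 1)) K) :=
    .of fun i j => MvPolynomial.X ⟨i + j, by omega⟩
  let N' : Matrix (Fin (n + 1)) (Fin (d + 1 - n)) (MvPolynomial (Fin (d + 1)) K) :=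
    N.map MvPolynomial.C
  have hF : ∀ b : ℕ → K, MvPolynomial.eval (fun i : Fin (d + 1) => b i)
      (N' * G).det = (N * H b).det := by
    intro b
    rw [RingHom.map_det, RingHom.mapMatrix_apply, Matrix.map_mul]
    congr 2
    · ext i j; simp [N']
    · ext i j; simp [G, H]
  refine ⟨(N' * G).det, fun b hb => ?_, ?_⟩
  · rw [hF]
    obtain ⟨w, hw0, hw⟩ := (hH b).mp hb
    refine Matrix.exists_mulVec_eq_zero_iff.mp ⟨w, hw0, ?_⟩
    rw [← Matrix.mulVec_mulVec, hw, Matrix.mulVec_zero]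
  · rw [hF, hN, Matrix.det_one]
    exact one_ne_zero

end Sequences

/-! ### From binary forms to sequences -/

section Forms

variable {K : Type*} [Field K]

/-- The coefficients of a form with respect to the basis `(d.choose i) x^(d-i) y^i`. -/
noncomputable def moments (d : ℕ) : Forms K d →ₗ[K] (ℕ → K) where
  toFun q i := (d.choose i : K)⁻¹ * MvPolynomial.coeff
    (Finsupp.single 0 (d - i) + Finsupp.single 1 i) (q : MvPolynomial (Fin 2) K)
  map_add' p q := by
    ext i
    simp [mul_add]
  map_smul' c q := by
    ext i
    simp [mul_left_comm]

variable {d : ℕ}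

lemma moments_apply (q : Forms K d) (i : ℕ) :
    moments d q i = (d.choose i : K)⁻¹ * MvPolynomial.coeff
      (Finsupp.single 0 (d - i) + Finsupp.single 1 i) (q : MvPolynomial (Fin 2) K) := rfl

lemma choose_ne_zero [CharZero K] {i : ℕ} (hi : i ≤ d) : (d.choose i : K) ≠ 0 :=
  Nat.cast_ne_zero.mpr (Nat.choose_pos hi).ne'

lemma coords_eq_choose_mul_moments [CharZero K] (q : Forms K d) (i : Fin (d + 1)) :
    coords q i = d.choose i * moments d q i := by
  rw [moments_apply, mul_inv_cancel_left₀ (choose_ne_zero (by omega))]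
  rfl

lemma moments_eq_inv_choose_mul_coords (q : Forms K d) (i : Fin (d + 1)) :
    moments d q i = (d.choose i : K)⁻¹ * coords q i := rfl

lemma ext_moments [CharZero K] {p q : Forms K d} (h : ∀ i ≤ d, moments d p i = moments d q i) :
    p = q := by
  refine Subtype.ext (MvPolynomial.ext _ _ fun m => ?_)
  by_cases hm : m.degree = d
  · have hm2 : m 0 + m 1 = d := by
      rw [← hm, Finsupp.degree_eq_sum, Fin.sum_univ_two]
    have key : m = Finsupp.single 0 (d - m 1) + Finsupp.single 1 (m 1) := by
      ext i
      fin_cases i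
      · simp; omega
      · simp
    have := h (m 1) (by omega)
    rw [moments_apply, moments_apply, ← key] at this
    exact mul_left_cancel₀ (inv_ne_zero (choose_ne_zero (by omega))) this
  · have hp : (p : MvPolynomial (Fin 2) K).IsHomogeneous d := p.2
    have hq : (q : MvPolynomial (Fin 2) K).IsHomogeneous d := q.2
    rw [hp.coeff_eq_zero hm, hq.coeff_eq_zero hm]

lemma single_add_single_inj {i j : ℕ} :
    (Finsupp.single 0 (d - j) + Finsupp.single 1 j : Fin 2 →₀ ℕ) =
      Finsupp.single 0 (d - i) + Finsupp.single 1 i ↔ j = i := by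
  refine ⟨fun h => ?_, fun h => by rw [h]⟩
  simpa using DFunLike.congr_fun h 1

/-- The form with given moments. -/
noncomputable def ofMoments (d : ℕ) (a : ℕ → K) : Forms K d :=
  ⟨∑ i ∈ range (d + 1), MvPolynomial.monomial
      (Finsupp.single 0 (d - i) + Finsupp.single 1 i) ((d.choose i : K) * a i), by
    refine Submodule.sum_mem _ fun i hi => MvPolynomial.isHomogeneous_monomial _ ?_
    rw [mem_range] at hi
    rw [map_add, Finsupp.degree_single, Finsupp.degree_single]
    omega⟩

lemma moments_ofMoments [CharZero K] (a : ℕ → K) {i : ℕ} (hi : i ≤ d) :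
    moments d (ofMoments d a) i = a i := by
  rw [moments_apply, ofMoments, MvPolynomial.coeff_sum, sum_eq_single i]
  · rw [MvPolynomial.coeff_monomial, if_pos rfl, inv_mul_cancel_left₀ (choose_ne_zero hi)]
  · intro j _ hji
    rw [MvPolynomial.coeff_monomial, if_neg]
    rwa [single_add_single_inj]
  · intro h
    exact absurd (mem_range.mpr (by omega)) h

/-- The linear form `u x + v y`. -/
noncomputable def linearForm (u v : K) : Forms K 1 :=
  ⟨MvPolynomial.C u * MvPolynomial.X 0 + MvPolynomial.C v * MvPolynomial.X 1, by
    refine Submodule.add_mem _ ?_ ?_ <;>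
    exact MvPolynomial.isHomogeneous_C_mul_X _ _⟩

lemma moments_powForm_linearForm [CharZero K] (u v : K) {i : ℕ} (hi : i ≤ d) :
    moments d (powForm d (linearForm u v)) i = u ^ (d - i) * v ^ i := by
  suffices h : powForm d (linearForm u v) = ofMoments d fun i => u ^ (d - i) * v ^ i by
    rw [h, moments_ofMoments _ hi]
  refine Subtype.ext ?_
  change (MvPolynomial.C u * MvPolynomial.X 0 + MvPolynomial.C v * MvPolynomial.X 1) ^ d =
    ∑ i ∈ range (d + 1), _
  rw [add_comm, add_pow]
  refine sum_congr rfl fun i _ => ?_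
  rw [mul_pow, mul_pow, MvPolynomial.monomial_eq, Finsupp.prod_add_index', Finsupp.prod_single_index,
    Finsupp.prod_single_index]
  · simp only [map_mul, map_pow, map_natCast]
    ring
  · simp
  · simp
  · simp
  · intros
    rw [pow_add]

lemma exists_eq_linearForm [CharZero K] (L : Forms K 1) : ∃ u v, L = linearForm u v := by
  refine ⟨moments 1 L 0, moments 1 L 1, ext_moments fun i hi => ?_⟩
  have h1 : linearForm (moments 1 L 0) (moments 1 L 1) =
      powForm 1 (linearForm (moments 1 L 0) (moments 1 L 1)) :=
    Subtype.ext (pow_one _).symm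
  rw [h1, moments_powForm_linearForm _ _ hi]
  interval_cases i <;> simp

lemma linearForm_ne_zero [CharZero K] {u v : K} (h : u ≠ 0 ∨ v ≠ 0) : linearForm u v ≠ 0 := by
  intro h0
  have h1 : powForm 1 (linearForm u v) = 0 := by
    rw [h0]
    exact Subtype.ext (pow_one _)
  have hu := moments_powForm_linearForm u v (zero_le_one' ℕ)
  have hv := moments_powForm_linearForm u v (le_refl 1)
  rw [h1, map_zero] at hu hv
  simp only [Pi.zero_apply, tsub_zero, pow_one, pow_zero, mul_one, tsub_self, one_mul] at hu hv
  rcases h with h | h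
  · exact h hu.symm
  · exact h hv.symm

lemma exists_eq_sum_powForm_iff [CharZero K] {q : Forms K d} {s : ℕ} :
    (∃ L : Fin s → Forms K 1, q = ∑ i, powForm d (L i)) ↔ PowSum d (moments d q) s := by
  constructor
  · rintro ⟨L, rfl⟩
    choose u v huv using fun i => exists_eq_linearForm (L i)
    refine ⟨u, v, fun i hi => ?_⟩
    rw [map_sum, Finset.sum_apply]
    exact sum_congr rfl fun l _ => by rw [huv, moments_powForm_linearForm _ _ hi]
  · rintro ⟨u, v, h⟩
    refine ⟨fun l => linearForm (u l) (v l), ext_moments fun i hi => ?_⟩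
    rw [h i hi, map_sum, Finset.sum_apply]
    exact sum_congr rfl fun l _ => by rw [moments_powForm_linearForm _ _ hi]

lemma hasRank_iff [CharZero K] {q : Forms K d} {r : ℕ} :
    HasRank q r ↔ PowSum d (moments d q) r ∧ ∀ s, PowSum d (moments d q) s → r ≤ s := by
  rw [HasRank, IsLeast, mem_lowerBounds]
  simp only [Set.mem_ofPred_eq, exists_eq_sum_powForm_iff]

/-- A shortest expression as a sum of powers uses pairwise independent linear forms. -/
lemma exists_independent_of_minimal [IsAlgClosed K] {d r : ℕ} (hd : d ≠ 0) {a : ℕ → K}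
    (h : PowSum d a r) (hmin : ∀ s, PowSum d a s → r ≤ s) :
    ∃ u v : Fin r → K, (∀ l, u l ≠ 0 ∨ v l ≠ 0) ∧ (∀ i j, i ≠ j → u i * v j ≠ u j * v i) ∧
      ∀ i ≤ d, a i = ∑ l, u l ^ (d - i) * v l ^ i := by
  obtain ⟨u, v, ha⟩ := h
  have hne : ∀ l, u l ≠ 0 ∨ v l ≠ 0 := by
    by_contra! hcon
    obtain ⟨l, hu, hv⟩ := hcon
    obtain ⟨s, rfl⟩ : ∃ s, r = s + 1 := ⟨r - 1, by have := l.2; omega⟩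
    have : PowSum d a s := by
      refine ⟨fun m => u (l.succAbove m), fun m => v (l.succAbove m), fun i hi => ?_⟩
      have h0 : u l ^ (d - i) * v l ^ i = 0 := by
        rw [hu, hv, ← pow_add, Nat.sub_add_cancel hi, zero_pow hd]
      rw [ha i hi, Fin.sum_univ_succAbove _ l, h0, zero_add]
    have := hmin s this
    omega
  refine ⟨u, v, hne, fun i j hij heq => ?_, ha⟩
  obtain ⟨c, hcu, hcv⟩ : ∃ c, u j = c * u i ∧ v j = c * v i := by
    rcases hne i with h0 | h0
    · exact ⟨u j / u i, by field_simp, by field_simp; linear_combination heq⟩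
    · exact ⟨v j / v i, by field_simp; linear_combination -heq, by field_simp⟩
  obtain ⟨s, rfl⟩ : ∃ s, r = s + 1 := ⟨r - 1, by have := i.2; omega⟩
  obtain ⟨m, rfl⟩ := Fin.exists_succAbove_eq hij
  have : PowSum d a s := by
    -- The two proportional powers merge into one with coefficient `1 + c ^ d`, contradicting
    -- minimality.
    refine powSum_of_eq_sum hd (c := fun l => if l = m then 1 + c ^ d else 1)
      (u := fun l => u (j.succAbove l)) (v := fun l => v (j.succAbove l)) fun e he => ?_
    have hj : u j ^ (d - e) * v j ^ e =
        c ^ d * (u (j.succAbove m) ^ (d - e) * v (j.succAbove m) ^ e) := by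
      rw [hcu, hcv, mul_pow, mul_pow, ← Nat.sub_add_cancel he, Nat.add_sub_cancel, pow_add]
      ring
    have hif : ∀ l, (if l = m then 1 + c ^ d else 1) = 1 + if l = m then c ^ d else 0 := by
      intro l
      split_ifs <;> ring
    rw [ha e he, Fin.sum_univ_succAbove _ j, hj]
    simp only [hif, add_mul, one_mul, sum_add_distrib, ite_mul, zero_mul, sum_ite_eq', mem_univ,
      if_true]
    ring
  have := hmin s this
  omega

end Forms

/-! ### Zariski closures and ranks -/

section Closure

variable {K : Type*} [Field K] {d : ℕ}

lemma subset_zariskiClosure (A : Set (Forms K d)) : A ⊆ zariskiClosure A :=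
  fun _ hq _ hF => hF _ hq

lemma algHom_aeval_eq_eval {σ A : Type*} [CommRing A] [Algebra K A] (φ : A →ₐ[K] K) (f : σ → A)
    (F : MvPolynomial σ K) :
    φ (MvPolynomial.aeval f F) = MvPolynomial.eval (fun i => φ (f i)) F := by
  rw [MvPolynomial.comp_aeval_apply]
  rfl

/-- The limit of a polynomial family in the closure of `A` lies in the closure of `A`. -/
lemma mem_zariskiClosure_of_family [CharZero K] {A : Set (Forms K d)} {q : Forms K d}
    (P : ℕ → K[X]) (hP : ∀ i ≤ d, (P i).eval 0 = moments d q i) {T : Set K} (hT : T.Finite)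
    (h : ∀ t ∉ T, ∃ p ∈ zariskiClosure A, ∀ i ≤ d, (P i).eval t = moments d p i) :
    q ∈ zariskiClosure A := by
  intro F hF
  -- `F` restricted to the curve is a polynomial in `t` with infinitely many zeros, so it also
  -- vanishes at `t = 0`.
  let Q : K[X] := MvPolynomial.aeval (fun i : Fin (d + 1) => C (d.choose i : K) * P i) F
  have hQ : ∀ (t : K) (p : Forms K d), (∀ i ≤ d, (P i).eval t = moments d p i) →
      Q.eval t = MvPolynomial.eval (coords p) F := by
    intro t p hp
    have h1 : (fun i : Fin (d + 1) => (C (d.choose i : K) * P i).eval t) = coords p := by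
      ext i
      rw [eval_mul, eval_C, hp i (by omega), coords_eq_choose_mul_moments]
    rw [← h1]
    simpa only [coe_aeval_eq_eval] using algHom_aeval_eq_eval (aeval t) _ F
  have hQ0 : Q = 0 := by
    refine eq_zero_of_infinite_isRoot Q (hT.infinite_compl.mono fun t ht => ?_)
    obtain ⟨p, hpA, hp⟩ := h t ht
    exact (hQ t p hp).trans (hpA F hF)
  rw [← hQ 0 q hP, hQ0, eval_zero]

lemma hasApolar_of_mem_zariskiClosure [CharZero K] {r : ℕ} {q : Forms K d}
    (hq : q ∈ zariskiClosure (formsOfRank K d r)) : HasApolar d r (moments d q) := by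
  by_contra hcon
  obtain ⟨F, hF, hFq⟩ := exists_mvPolynomial_of_not_hasApolar hcon
  let G : MvPolynomial (Fin (d + 1)) K :=
    MvPolynomial.aeval
      (fun i : Fin (d + 1) => MvPolynomial.C (d.choose i : K)⁻¹ * MvPolynomial.X i) F
  have hG : ∀ p : Forms K d, MvPolynomial.eval (coords p) G =
      MvPolynomial.eval (fun i : Fin (d + 1) => moments d p i) F := by
    intro p
    have h := algHom_aeval_eq_eval (MvPolynomial.aeval (coords p))
      (fun i : Fin (d + 1) => MvPolynomial.C (d.choose i : K)⁻¹ * MvPolynomial.X i) F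
    simp only [map_mul, MvPolynomial.aeval_C, MvPolynomial.aeval_X, Algebra.algebraMap_self,
      RingHom.id_apply, ← moments_eq_inv_choose_mul_coords] at h
    exact h
  refine hFq ?_
  rw [← hG]
  refine hq G fun p hp => ?_
  rw [hG]
  exact hF _ ((hasRank_iff.mp hp).1.hasApolar le_rfl)

lemma HasRank.hasApolar [CharZero K] {r n : ℕ} {q : Forms K d} (hq : HasRank q r) (h : r ≤ n) :
    HasApolar d n (moments d q) :=
  (hasRank_iff.mp hq).1.hasApolar h

variable [IsAlgClosed K] [CharZero K]

/-- A shorter expression would give an annihilator of degree `r - 1`; excluding it by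
`HasApolar.card_le` needs `(r - 1) + r ≤ d + 1`. -/
lemma hasRank_of_eq_sum (hd : d ≠ 0) {r : ℕ} (hr : 2 * r ≤ d + 2) {q : Forms K d}
    {c x : Fin r → K} (hx : Function.Injective x) (hc : ∀ l, c l ≠ 0)
    (h : ∀ i ≤ d, moments d q i = ∑ l, c l * x l ^ i) : HasRank q r := by
  have h' : ∀ i ≤ d, moments d q i = ∑ l, c l * ((fun _ => 1 : Fin r → K) l ^ (d - i) * x l ^ i) :=
    by simpa using h
  refine hasRank_iff.mpr ⟨powSum_of_eq_sum hd h', fun s hs => ?_⟩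
  by_contra! hlt
  have := (hs.hasApolar (n := r - 1) (by omega)).card_le (fun _ => Or.inl one_ne_zero) hc
    (fun i j hij => by simpa using (hx.ne hij).symm) h' (by omega)
  omega

/-- Some `c l` may vanish and lower the rank. Replacing every `c l` by `c l + t` gives rank exactly
`r` for all but finitely many `t`. -/
lemma mem_zariskiClosure_of_eq_sum (hd : d ≠ 0) {r : ℕ} (hr : 2 * r ≤ d + 2) {q : Forms K d}
    {c x : Fin r → K} (hx : Function.Injective x)
    (h : ∀ i ≤ d, moments d q i = ∑ l, c l * x l ^ i) :
    q ∈ zariskiClosure (formsOfRank K d r) := by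
  refine mem_zariskiClosure_of_family (fun i => ∑ l, (C (c l) + X) * C (x l ^ i))
    (fun i hi => ?_) (Set.finite_range fun l => -c l) fun t ht => ?_
  · rw [h i hi, eval_finsetSum]
    simp
  · have hp : ∀ i ≤ d, moments d (ofMoments d fun i => ∑ l, (c l + t) * x l ^ i) i =
        ∑ l, (c l + t) * x l ^ i := fun i hi => moments_ofMoments _ hi
    refine ⟨_, subset_zariskiClosure _ (hasRank_of_eq_sum hd hr hx (fun l h0 => ht ⟨l, ?_⟩) hp),
      fun i hi => ?_⟩
    · linear_combination -h0
    · rw [hp i hi, eval_finsetSum]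
      simp

/-- The closure of the set of forms of rank `r` is given by apolarity. -/
lemma mem_zariskiClosure_formsOfRank_iff (hd : d ≠ 0) {r : ℕ} (hr : 2 * r ≤ d + 2) (hrd : r ≤ d)
    {q : Forms K d} :
    q ∈ zariskiClosure (formsOfRank K d r) ↔ HasApolar d r (moments d q) := by
  refine ⟨hasApolar_of_mem_zariskiClosure, fun h => ?_⟩
  obtain ⟨P, hP0, T, hT, hP⟩ := h.exists_deformation hrd
  refine mem_zariskiClosure_of_family P hP0 hT fun t ht => ?_
  obtain ⟨c, x, hx, h⟩ := hP t ht
  refine ⟨ofMoments d fun i => (P i).eval t, ?_, fun i hi => by rw [moments_ofMoments _ hi]⟩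
  exact mem_zariskiClosure_of_eq_sum hd hr hx fun i hi => by rw [moments_ofMoments _ hi, h i hi]

lemma HasRank.le_of_hasApolar (hd : d ≠ 0) {r n : ℕ} {q : Forms K d} (hq : HasRank q r)
    (hn : HasApolar d n (moments d q)) (h : n + r ≤ d + 1) : r ≤ n := by
  obtain ⟨h1, h2⟩ := hasRank_iff.mp hq
  obtain ⟨u, v, hne, huv, ha⟩ := exists_independent_of_minimal hd h1 h2
  exact hn.card_le (c := fun _ => 1) hne (fun _ => one_ne_zero) huv (by simpa using ha) h

/-- Forms whose lowest annihilator has degree `k + 1` are those of rank `k + 1` or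
`d - k + 1`. -/
lemma hasApolar_and_not_hasApolar_iff (hd : d ≠ 0) {k : ℕ} (hk : 2 * k ≤ d) {q : Forms K d} :
    HasApolar d (k + 1) (moments d q) ∧ ¬ HasApolar d k (moments d q) ↔
      HasRank q (k + 1) ∨ HasRank q (d - k + 1) := by
  classical
  constructor
  · rintro ⟨h1, h2⟩
    have hex : PowSum d (moments d q) (d - k + 1) := powSum_of_not_hasApolar hd (by omega) h2
    obtain ⟨s, hs⟩ : ∃ s, HasRank q s :=
      ⟨Nat.find ⟨_, hex⟩, hasRank_iff.mpr ⟨Nat.find_spec ⟨_, hex⟩, fun s hs => Nat.find_min' _ hs⟩⟩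
    have hle : s ≤ d - k + 1 := (hasRank_iff.mp hs).2 _ hex
    have hgt : k < s := by
      by_contra! hcon
      exact h2 (hs.hasApolar hcon)
    by_cases hsd : s = d - k + 1
    · exact Or.inr (hsd ▸ hs)
    -- Here `s ≤ d - k`, so `(k + 1) + s ≤ d + 1` and the annihilator of degree `k + 1` forces `s ≤
    -- k + 1`.
    · have := hs.le_of_hasApolar hd h1 (by omega)
      obtain rfl : s = k + 1 := by omega
      exact Or.inl hs
  · intro h
    have hno : ∀ r, HasRank q r → k < r → k + r ≤ d + 1 → ¬ HasApolar d k (moments d q) := by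
      intro r hr hkr hrd hap
      have := hr.le_of_hasApolar hd hap hrd
      omega
    rcases h with h | h
    · exact ⟨h.hasApolar le_rfl, hno _ h (by omega) (by omega)⟩
    · refine ⟨?_, hno _ h (by omega) (by omega)⟩
      -- Without an annihilator of degree `k + 1`, `q` would be a sum of `d - (k + 1) + 1 = d - k`
      -- powers, fewer than its rank.
      by_contra hcon
      have hlt : 2 * (k + 1) ≤ d := by
        by_contra! hlt
        exact hcon (hasApolar_of_lt _ hlt)
      have := (hasRank_iff.mp h).2 _ (powSum_of_not_hasApolar hd (by omega) hcon)
      omega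

end Closure

/-! ### Degree zero -/

section DegreeZero

variable {K : Type*} [Field K] [CharZero K]

/-- Every zeroth power is 1, even that of the zero form, so a sum of `s` powers is the constant `s`.
-/
lemma hasRank_degree_zero_iff {q : Forms K 0} {r : ℕ} : HasRank q r ↔ moments 0 q 0 = r := by
  have h : ∀ s : ℕ, PowSum 0 (moments 0 q) s ↔ moments 0 q 0 = s := by
    intro s
    constructor
    · rintro ⟨u, v, h⟩
      simpa using h 0 le_rfl
    · intro h
      refine ⟨0, 0, fun i hi => ?_⟩
      obtain rfl : i = 0 := by omega
      simpa using h
  simp only [hasRank_iff, h]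
  refine ⟨fun h => h.1, fun h => ⟨h, fun s hs => ?_⟩⟩
  exact (Nat.cast_injective (R := K) (h.symm.trans hs)).le

lemma mem_zariskiClosure_degree_zero_iff {q : Forms K 0} {r : ℕ} :
    q ∈ zariskiClosure (formsOfRank K 0 r) ↔ HasRank q r := by
  refine ⟨fun h => ?_, fun h => subset_zariskiClosure _ h⟩
  have hc : ∀ p : Forms K 0, coords p 0 = moments 0 p 0 := fun p => by
    rw [coords_eq_choose_mul_moments]
    simp
  have := h (MvPolynomial.X 0 - MvPolynomial.C (r : K)) fun p hp => by
    rw [map_sub, MvPolynomial.eval_X, MvPolynomial.eval_C, hc, hasRank_degree_zero_iff.mp hp,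
      sub_self]
  rw [map_sub, MvPolynomial.eval_X, MvPolynomial.eval_C, hc, sub_eq_zero] at this
  exact hasRank_degree_zero_iff.mpr this

end DegreeZero

/-! ### Secant planes and sums of powers -/

section Secant

open scoped LinearAlgebra.Projectivization

variable {K : Type*} [Field K] [CharZero K] {d k : ℕ}

lemma linearIndependent_powForm {s : ℕ} (hs : s ≤ d + 1) {u v : Fin s → K}
    (hne : ∀ l, u l ≠ 0 ∨ v l ≠ 0) (huv : ∀ i j, i ≠ j → u i * v j ≠ u j * v i) :
    LinearIndependent K fun l => powForm d (linearForm (u l) (v l)) := by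
  rw [Fintype.linearIndependent_iff]
  intro c hc
  refine congrFun (geometric_independent hs hne huv fun i hi => ?_)
  have := congrFun (congrArg (moments d) hc) i
  rw [map_zero, map_sum, Finset.sum_apply, Pi.zero_apply] at this
  rw [← this]
  refine sum_congr rfl fun l _ => ?_
  rw [map_smul, Pi.smul_apply, smul_eq_mul, moments_powForm_linearForm _ _ hi]

lemma exists_isSecantPlane_of_eq_sum (hk : k ≤ d) {q : Forms K d} (hq : q ≠ 0)
    {u v : Fin (k + 1) → K} (hne : ∀ l, u l ≠ 0 ∨ v l ≠ 0)
    (huv : ∀ i j, i ≠ j → u i * v j ≠ u j * v i)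
    (h : ∀ i ≤ d, moments d q i = ∑ l, u l ^ (d - i) * v l ^ i) :
    ∃ W : Projectivization.Subspace K (Forms K d),
      IsSecantPlane k W ∧ Projectivization.mk K q hq ∈ W := by
  have hli := linearIndependent_powForm (d := d) (by omega) hne huv
  let P : Fin (k + 1) → ℙ K (Forms K d) := fun l => Projectivization.mk K _ (hli.ne_zero l)
  refine ⟨Projectivization.Subspace.span (Set.range P), ⟨P, .mk _ hli.ne_zero hli, fun l =>
    ⟨_, linearForm_ne_zero (hne l), hli.ne_zero l, rfl⟩, rfl⟩, ?_⟩
  have hsum : q = ∑ l, powForm d (linearForm (u l) (v l)) := by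
    refine ext_moments fun i hi => ?_
    rw [h i hi, map_sum, Finset.sum_apply]
    exact sum_congr rfl fun l _ => (moments_powForm_linearForm _ _ hi).symm
  rw [← Projectivization.Subspace.mem_submodule_iff, hsum]
  refine Submodule.sum_mem _ fun l _ => ?_
  rw [Projectivization.Subspace.mem_submodule_iff _ (hli.ne_zero l)]
  exact Projectivization.Subspace.subset_span _ ⟨l, rfl⟩

lemma IsSecantPlane.powSum [IsAlgClosed K] (hd : d ≠ 0)
    {W : Projectivization.Subspace K (Forms K d)} (hW : IsSecantPlane k W) {q : Forms K d}
    (hq : q ≠ 0) (hqW : Projectivization.mk K q hq ∈ W) : PowSum d (moments d q) (k + 1) := by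
  obtain ⟨P, -, hP, rfl⟩ := hW
  choose L _ hL hPL using hP
  have hle : Projectivization.Subspace.span (Set.range P) ≤
      (Submodule.span K (Set.range fun l => powForm d (L l))).projectivization := by
    rw [Projectivization.Subspace.span_le_subspace_iff]
    rintro _ ⟨l, rfl⟩
    rw [hPL l, SetLike.mem_coe, Submodule.mk_mem_projectivization_iff]
    exact Submodule.subset_span ⟨l, rfl⟩
  have hmem := hle hqW
  rw [Submodule.mk_mem_projectivization_iff] at hmem
  obtain ⟨c, rfl⟩ := (Submodule.mem_span_range_iff_exists_fun K).mp hmem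
  choose u v huv using fun l => exists_eq_linearForm (L l)
  refine powSum_of_eq_sum hd (c := c) (u := u) (v := v) fun i hi => ?_
  rw [map_sum, Finset.sum_apply]
  refine sum_congr rfl fun l _ => ?_
  rw [map_smul, Pi.smul_apply, smul_eq_mul, huv, moments_powForm_linearForm _ _ hi]

end Secant

end BinaryForm

theorem theorem2 {K : Type*} [Field K] [IsAlgClosed K] [CharZero K] (d k : ℕ) (hk : k ≤ d / 2) :
    BinaryForm.zariskiClosure (BinaryForm.formsOfRank K d (k + 1)) \
        BinaryForm.zariskiClosure (BinaryForm.formsOfRank K d k) =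
      BinaryForm.formsOfRank K d (k + 1) ∪ BinaryForm.formsOfRank K d (d - k + 1) ∧
    ∀ (q : BinaryForm.Forms K d) (hq : q ≠ 0),
      q ∈ BinaryForm.zariskiClosure (BinaryForm.formsOfRank K d (k + 1)) \
        BinaryForm.zariskiClosure (BinaryForm.formsOfRank K d k) →
      (BinaryForm.HasRank q (k + 1) ↔
        ∃ W : Projectivization.Subspace K (BinaryForm.Forms K d),
          BinaryForm.IsSecantPlane k W ∧ Projectivization.mk K q hq ∈ W) ∧
      ((¬ ∃ W : Projectivization.Subspace K (BinaryForm.Forms K d),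
          BinaryForm.IsSecantPlane k W ∧ Projectivization.mk K q hq ∈ W) →
        BinaryForm.HasRank q (d - k + 1)) := by
  open BinaryForm in
  -- In degree zero coefficients cannot be absorbed by `d`-th roots; there each rank set is a single
  -- constant and is closed.
  rcases eq_or_ne d 0 with rfl | hd
  · obtain rfl : k = 0 := by omega
    refine ⟨?_, fun q hq hmem => ?_⟩
    · ext q
      rw [Set.mem_sdiff, mem_zariskiClosure_degree_zero_iff, mem_zariskiClosure_degree_zero_iff]
      change _ ↔ HasRank q 1 ∨ HasRank q 1
      simp only [hasRank_degree_zero_iff, or_self]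
      refine ⟨fun h => h.1, fun h => ⟨h, ?_⟩⟩
      rw [h]
      simp
    · have h1 : HasRank q 1 := mem_zariskiClosure_degree_zero_iff.mp hmem.1
      refine ⟨⟨fun _ => ?_, fun _ => h1⟩, fun _ => h1⟩
      refine exists_isSecantPlane_of_eq_sum le_rfl hq (u := fun _ => 1) (v := fun _ => 0)
        (fun _ => Or.inl one_ne_zero) (fun i j hij => absurd (Fin.ext (by omega)) hij)
        fun i hi => ?_
      obtain rfl : i = 0 := by omega
      rw [hasRank_degree_zero_iff.mp h1]
      simp
  · have hmem : ∀ q : Forms K d, q ∈ zariskiClosure (formsOfRank K d (k + 1)) \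
        zariskiClosure (formsOfRank K d k) ↔ HasRank q (k + 1) ∨ HasRank q (d - k + 1) := by
      intro q
      rw [Set.mem_sdiff, mem_zariskiClosure_formsOfRank_iff hd (by omega) (by omega),
        mem_zariskiClosure_formsOfRank_iff hd (by omega) (by omega),
        hasApolar_and_not_hasApolar_iff hd (by omega)]
    refine ⟨Set.ext hmem, fun q hq hqm => ?_⟩
    have hiff : HasRank q (k + 1) ↔ ∃ W : Projectivization.Subspace K (Forms K d),
        IsSecantPlane k W ∧ Projectivization.mk K q hq ∈ W := by
      constructor
      · intro h
        obtain ⟨h1, h2⟩ := hasRank_iff.mp h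
        obtain ⟨u, v, hne, huv, ha⟩ := exists_independent_of_minimal hd h1 h2
        exact exists_isSecantPlane_of_eq_sum (by omega) hq hne huv ha
      · rintro ⟨W, hW, hqW⟩
        rcases (hmem q).mp hqm with h | h
        · exact h
        -- A form of rank `d - k + 1` on a secant `k`-plane has `d - k + 1 ≤ k + 1`; then `d = 2 *
        -- k` and both ranks coincide.
        · have := (hasRank_iff.mp h).2 _ (hW.powSum hd hq hqW)
          obtain h' : d - k + 1 = k + 1 := by omega
          rwa [h'] at h
    exact ⟨hiff, fun hno => ((hmem q).mp hqm).resolve_left fun h => hno (hiff.mp h)⟩
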